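/- For a nonzero polynomial $P\in\mathbb C[x,y]$ let $$ m(P)=\frac1{(2\pi i)^2}\iint_{|x|=|y|=1}\log|P(x,y)|\,\frac{dx}{x}\,\frac{dy}{y} =\frac1{(2\pi)^2}\int_0^{2\pi}\!\!\int_0^{2\pi}\log\bigl|P(e^{is},e^{it})\bigr|\,ds\,dt $$ denote its (logarithmic) Mahler measure. For $k\in\mathbb R$ put $$ P_k(x,y)=(x+1)y^2+(x^2+kx+1)y+(x^2+x), $$ $$ Q_k(X,Y)=Y^2+(X^4+kX^3+2kX^2+kX+1)Y+X^4 . $$ Then for every real $k$ the integrals defining $m(Q_k)$ and $m(P_{2-k})$ converge absolutely, and $$ m(Q_k)=\begin{cases}2\,m(P_{2-k}) & \text{for } 0\le k\le 4,\\ m(P_{2-k}) & \text{for } k\le -1.\end{cases} $$ -/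

import Mathlib

open MvPolynomial in
/-- Boyd's family `P_k(x, y) = (x + 1) y² + (x² + k x + 1) y + (x² + x)`,
with `x = X 0` and `y = X 1`. -/
noncomputable def boydP (k : ℂ) : MvPolynomial (Fin 2) ℂ :=
  (X 0 + 1) * X 1 ^ 2 + (X 0 ^ 2 + C k * X 0 + 1) * X 1 + (X 0 ^ 2 + X 0)

open MvPolynomial in
/-- Bosman's family `Q_k(X, Y) = Y² + (X⁴ + k X³ + 2 k X² + k X + 1) Y + X⁴`,
with `X = X 0` and `Y = X 1`. -/
noncomputable def bosmanQ (k : ℂ) : MvPolynomial (Fin 2) ℂ :=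
  X 1 ^ 2
    + (X 0 ^ 4 + C k * X 0 ^ 3 + C (2 * k) * X 0 ^ 2 + C k * X 0 + 1) * X 1
    + X 0 ^ 4

/-- `log |P|` on the torus `|x| = |y| = 1`, in the coordinates `x = exp(i s)`, `y = exp(i t)`,
`θ = (s, t)`. -/
noncomputable def logNormOnTorus (P : MvPolynomial (Fin 2) ℂ) (θ : ℝ × ℝ) : ℝ :=
  Real.log ‖MvPolynomial.eval
    ![Complex.exp (θ.1 * Complex.I), Complex.exp (θ.2 * Complex.I)] P‖

/-- One period `[0, 2π] × [0, 2π]` of the torus coordinates. -/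
def torusPeriod : Set (ℝ × ℝ) :=
  Set.Icc 0 (2 * Real.pi) ×ˢ Set.Icc 0 (2 * Real.pi)

/-- The integral defining the Mahler measure of `P` converges absolutely. -/
def MahlerIntegrable (P : MvPolynomial (Fin 2) ℂ) : Prop :=
  MeasureTheory.IntegrableOn (logNormOnTorus P) torusPeriod MeasureTheory.volume

/-- The logarithmic Mahler measure
`m(P) = (2πi)⁻² ∬_{|x|=|y|=1} log |P(x, y)| dx/x dy/y`;
under `x = exp(i s)`, `y = exp(i t)` the form `(2πi)⁻² dx/x dy/y` becomes `(2π)⁻² ds dt`. -/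
noncomputable def logMahler (P : MvPolynomial (Fin 2) ℂ) : ℝ :=
  ((2 * Real.pi) ^ 2)⁻¹ * ∫ θ in torusPeriod, logNormOnTorus P θ

/-! On the torus each polynomial is, up to a leading coefficient, `y² + 2uωy + ω²` with `|ω| = 1`
and `u` real and affine in `k`. Jensen's formula gives the mean over `y` as `arcosh |u|` truncated
to `0` when `|u| ≤ 1` (`jensenQ`, `jensenP`). The leading coefficient of `boydP` contributes `m(x +
1) = 0`.

Differentiating in the parameter `κ` gives integrals of `1 / √(u² - 1)` over `(0, π)`, that is,
periods of genus-one curves. Putting `p = κ - 2 cos s` on the Boyd side, and `w = 2 cos θ + κ - 1`,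
`p = w + (1 + κ) / w` on the Bosman side, turns both into the integral of `ell κ`. The involution `w
↦ (1 + κ) / w` decides the factor. For `κ < -1` only negative `w` occur, where the map is injective,
so the factor is 1 (`lintegral_densQ_of_lt`). For `0 < κ < 4` the relevant range `1 < w < 1 + κ` is
folded in two at `√(1 + κ)`, so the factor is 2 (`lintegral_densQ_of_mem_Ioo`).

It remains to integrate in `κ`. At `κ = 0` both Jensen terms vanish, which settles `[0, 4]`. On
`(-∞, -1]` the difference of the two measures is constant (`logMahler_sub_eq`), and it is zero
because both are `log |k| + o(1)` as `k → -∞`. -/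

open Real Set MeasureTheory Filter Topology

/-! ### Truncated `arcosh` as a primitive. -/

/-- `arcosh` extended by `0` to the left of `1`. -/
noncomputable def arcoshPlus (u : ℝ) : ℝ := arcosh (max 1 u)

lemma arcoshPlus_nonneg (u : ℝ) : 0 ≤ arcoshPlus u := arcosh_nonneg (le_max_left _ _)

lemma arcoshPlus_of_le_one {u : ℝ} (hu : u ≤ 1) : arcoshPlus u = 0 := by
  simp [arcoshPlus, max_eq_left hu]

lemma arcoshPlus_of_one_le {u : ℝ} (hu : 1 ≤ u) : arcoshPlus u = arcosh u := by
  simp [arcoshPlus, max_eq_right hu]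

lemma continuous_arcoshPlus : Continuous arcoshPlus :=
  continuousOn_arcosh.comp_continuous (by fun_prop) fun u => mem_Ici.2 (le_max_left 1 u)

lemma monotone_arcoshPlus : Monotone arcoshPlus := fun _ _ h =>
  (arcosh_le_arcosh (lt_max_of_lt_left one_pos) (lt_max_of_lt_left one_pos)).2
    (max_le_max_left 1 h)

lemma exp_arcoshPlus_le (u : ℝ) : exp (arcoshPlus u) ≤ 2 * max 1 u := by
  have h1 : (1 : ℝ) ≤ max 1 u := le_max_left _ _
  have h := cosh_arcosh h1
  rw [cosh_eq] at h
  have := exp_pos (-arcosh (max 1 u))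
  rw [arcoshPlus]
  linarith

lemma le_exp_arcoshPlus (u : ℝ) : 2 * max 1 u - 1 ≤ exp (arcoshPlus u) := by
  have h1 : (1 : ℝ) ≤ max 1 u := le_max_left _ _
  have h := cosh_arcosh h1
  rw [cosh_eq] at h
  have : exp (-arcosh (max 1 u)) ≤ 1 := by
    rw [exp_le_one_iff]; linarith [arcosh_nonneg h1]
  rw [arcoshPlus]
  linarith

lemma setLIntegral_eq_of_subset_of_ae_eq_zero {S T : Set ℝ} (hS : MeasurableSet S)
    (hT : MeasurableSet T) (hTS : T ⊆ S) {f : ℝ → ENNReal}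
    (hf : ∀ᵐ x, x ∈ S → x ∉ T → f x = 0) :
    ∫⁻ x in S, f x = ∫⁻ x in T, f x := by
  rw [← lintegral_indicator hS, ← lintegral_indicator hT]
  refine lintegral_congr_ae ?_
  filter_upwards [hf] with x hx
  by_cases h1 : x ∈ T
  · simp [h1, hTS h1]
  · by_cases h2 : x ∈ S
    · simp [h1, h2, hx h2 h1]
    · simp [h1, h2]

lemma lintegral_inv_sqrt_of_one_le {a b : ℝ} (ha : 1 ≤ a) (hab : a ≤ b) :
    ∫⁻ u in Ioc a b, ENNReal.ofReal (√(u ^ 2 - 1))⁻¹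
      = ENNReal.ofReal (arcoshPlus b - arcoshPlus a) := by
  have hder : ∀ x ∈ Ioo a b, HasDerivAt arcosh (√(x ^ 2 - 1))⁻¹ x := fun x hx =>
    hasDerivAt_arcosh (lt_of_le_of_lt ha hx.1)
  have hcont : ContinuousOn arcosh (Icc a b) :=
    continuousOn_arcosh.mono fun x hx => ha.trans hx.1
  have hInt : IntegrableOn (fun x : ℝ => (√(x ^ 2 - 1))⁻¹) (Ioc a b) :=
    intervalIntegral.integrableOn_deriv_of_nonneg hcont hder fun x _ => by positivity
  rw [← ofReal_integral_eq_lintegral_ofReal hInt (ae_of_all _ fun x => by positivity),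
    ← intervalIntegral.integral_of_le hab,
    intervalIntegral.integral_eq_sub_of_hasDerivAt_of_le hab hcont hder
      ((intervalIntegrable_iff_integrableOn_Ioc_of_le hab).2 hInt),
    arcoshPlus_of_one_le (ha.trans hab), arcoshPlus_of_one_le ha]

/-- For `-1 ≤ u ≤ 1` the default values of `√` and of the inverse make the integrand `0`, matching
the flat part of `arcoshPlus`. Below `-1` the integrand is positive again, hence the bound on `a`.
-/
lemma lintegral_inv_sqrt {a b : ℝ} (ha : -1 ≤ a) (hab : a ≤ b) :
    ∫⁻ u in Ioc a b, ENNReal.ofReal (√(u ^ 2 - 1))⁻¹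
      = ENNReal.ofReal (arcoshPlus b - arcoshPlus a) := by
  rcases le_total 1 a with h1 | h1
  · exact lintegral_inv_sqrt_of_one_le h1 hab
  have hz : ∀ u : ℝ, a < u → u ≤ 1 → ENNReal.ofReal (√(u ^ 2 - 1))⁻¹ = 0 := fun u h h' => by
    rw [sqrt_eq_zero_of_nonpos (by nlinarith)]; simp
  rcases le_total b 1 with h2 | h2
  · rw [arcoshPlus_of_le_one h1, arcoshPlus_of_le_one h2, sub_zero, ENNReal.ofReal_zero,
      setLIntegral_congr_fun measurableSet_Ioc fun u hu => hz u hu.1 (hu.2.trans h2)]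
    simp
  · rw [arcoshPlus_of_le_one h1, ← arcoshPlus_of_le_one le_rfl,
      ← lintegral_inv_sqrt_of_one_le le_rfl h2]
    refine setLIntegral_eq_of_subset_of_ae_eq_zero measurableSet_Ioc measurableSet_Ioc
      (Ioc_subset_Ioc_left h1) (ae_of_all _ fun u hu hu' => hz u hu.1 ?_)
    by_contra! h
    exact hu' ⟨h, hu.2⟩

lemma lintegral_inv_sqrt_affine {a b α β : ℝ} (hβ : 0 < β) (ha : -1 ≤ α + β * a) (hab : a ≤ b) :
    ∫⁻ x in Ioc a b, ENNReal.ofReal (β * (√((α + β * x) ^ 2 - 1))⁻¹)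
      = ENNReal.ofReal (arcoshPlus (α + β * b) - arcoshPlus (α + β * a)) := by
  rw [← lintegral_inv_sqrt ha (by gcongr)]
  have him : (fun x => α + β * x) '' Ioc a b = Ioc (α + β * a) (α + β * b) := by
    ext y
    constructor
    · rintro ⟨x, hx, rfl⟩
      exact ⟨by have := mul_lt_mul_of_pos_left hx.1 hβ; simpa using this,
        by have := mul_le_mul_of_nonneg_left hx.2 hβ.le; simpa using this⟩
    · rintro ⟨h1, h2⟩
      refine ⟨(y - α) / β, ⟨?_, ?_⟩, ?_⟩
      · rw [lt_div_iff₀ hβ]; linarith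
      · rw [div_le_iff₀ hβ]; linarith
      · field_simp; ring
  rw [← him, lintegral_image_eq_lintegral_abs_deriv_mul (f' := fun _ => β) measurableSet_Ioc]
  · refine lintegral_congr fun x => ?_
    rw [abs_of_pos hβ, ENNReal.ofReal_mul hβ.le]
  · intro x _
    simpa using (((hasDerivAt_id x).const_mul β).const_add α).hasDerivWithinAt
  · intro x _ y _ h
    have : β * x = β * y := by simpa using h
    exact mul_left_cancel₀ hβ.ne' this

/-! ### The elliptic integrand and the two substitutions. -/

/-- The elliptic integrand through which both families are compared. -/
noncomputable def ell (κ p : ℝ) : ℝ :=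
  (√((p ^ 2 - 4 * (1 + κ)) * ((κ + 2 - p) * (p + 2 - κ))))⁻¹

/-- Derivative in `κ` of the inner Jensen integral of `bosmanQ κ`. -/
noncomputable def densQ (κ θ : ℝ) : ℝ :=
  (1 + cos θ) * (√((2 * cos θ ^ 2 - 1 + (1 + cos θ) * κ) ^ 2 - 1))⁻¹

/-- Derivative in `κ` of the inner Jensen integral of `boydP (2 - κ)`. -/
noncomputable def densP (κ s : ℝ) : ℝ :=
  (4 * cos (s / 2))⁻¹ * (√((-cos (s / 2) + (4 * cos (s / 2))⁻¹ * κ) ^ 2 - 1))⁻¹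

lemma cos_half_pos {s : ℝ} (hs : s ∈ Ioo 0 π) : 0 < cos (s / 2) :=
  cos_pos_of_mem_Ioo ⟨by linarith [hs.1, pi_pos], by linarith [hs.2]⟩

lemma densP_eq (κ : ℝ) {s : ℝ} (hs : s ∈ Ioo 0 π) :
    densP κ s = (√((κ - 2 * cos s) ^ 2 - 4 * (1 + κ)))⁻¹ := by
  have hC := cos_half_pos hs
  have hcs : cos s = 2 * cos (s / 2) ^ 2 - 1 := by rw [← cos_two_mul]; congr 1; ring
  rw [densP, ← mul_inv, hcs]
  congr 1
  generalize cos (s / 2) = C at hC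
  have h4 : (4 * C) = √((4 * C) ^ 2) := (sqrt_sq (by positivity)).symm
  rw [h4, ← sqrt_mul (by positivity), ← h4]
  congr 1
  field_simp
  ring

/-- Substitute `p = κ - 2 cos s`: then `dp = 2 sin s ds`, and the last two factors in `ell` multiply
to `(2 sin s)²`. -/
lemma lintegral_densP (κ : ℝ) :
    ∫⁻ s in Ioo 0 π, ENNReal.ofReal (densP κ s)
      = ∫⁻ p in Ioo (κ - 2) (κ + 2), ENNReal.ofReal (ell κ p) := by
  have him : (fun s => κ - 2 * cos s) '' Ioo 0 π = Ioo (κ - 2) (κ + 2) := by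
    ext p
    constructor
    · rintro ⟨s, hs, rfl⟩
      have h1 : cos s < 1 := by
        simpa using cos_lt_cos_of_nonneg_of_le_pi le_rfl hs.2.le hs.1
      have h2 : -1 < cos s := by
        simpa using cos_lt_cos_of_nonneg_of_le_pi hs.1.le le_rfl hs.2
      exact ⟨by linarith, by linarith⟩
    · rintro ⟨h1, h2⟩
      refine ⟨arccos ((κ - p) / 2), ⟨arccos_pos.2 (by linarith), ?_⟩, ?_⟩
      · exact lt_of_le_of_ne (arccos_le_pi _) fun h => by
          have := arccos_eq_pi.1 h
          linarith
      · simp only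
        rw [cos_arccos (by linarith) (by linarith)]
        ring
  rw [← him, lintegral_image_eq_lintegral_abs_deriv_mul (f' := fun s => 2 * sin s)
    measurableSet_Ioo]
  · refine setLIntegral_congr_fun measurableSet_Ioo fun s hs => ?_
    have hsin : 0 < sin s := sin_pos_of_mem_Ioo hs
    rw [← ENNReal.ofReal_mul (abs_nonneg _), densP_eq κ hs, ell, abs_of_pos (by positivity)]
    congr 1
    have : (κ + 2 - (κ - 2 * cos s)) * (κ - 2 * cos s + 2 - κ) = (2 * sin s) ^ 2 := by
      nlinarith [sin_sq_add_cos_sq s]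
    rw [this, sqrt_mul' _ (sq_nonneg _), sqrt_sq (by positivity), mul_inv]
    field_simp
  · intro s _
    have := ((hasDerivAt_cos s).const_mul 2).const_sub κ
    exact (this.congr_deriv (by ring)).hasDerivWithinAt
  · intro x hx y hy h
    have : cos x = cos y := by simpa using h
    exact injOn_cos (Ioo_subset_Icc_self hx) (Ioo_subset_Icc_self hy) this

/-- The degree-two substitution identifying the differentials of the two families. -/
noncomputable def quadSubst (κ θ : ℝ) : ℝ :=
  (2 * cos θ + κ - 1) + (1 + κ) / (2 * cos θ + κ - 1)

/-- The derivative of `quadSubst κ`. -/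
noncomputable def quadSubstDeriv (κ θ : ℝ) : ℝ :=
  (1 - (1 + κ) / (2 * cos θ + κ - 1) ^ 2) * (-2 * sin θ)

lemma hasDerivAt_quadSubst {κ θ : ℝ} (hw : 2 * cos θ + κ - 1 ≠ 0) :
    HasDerivAt (quadSubst κ) (quadSubstDeriv κ θ) θ := by
  have h1 : HasDerivAt (fun θ => 2 * cos θ + κ - 1) (-2 * sin θ) θ := by
    have := (((hasDerivAt_cos θ).const_mul 2).add_const κ).sub_const 1
    exact this.congr_deriv (by ring)
  have := h1.add ((h1.inv hw).const_mul (1 + κ))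
  refine this.congr_deriv ?_
  unfold quadSubstDeriv
  field_simp
  ring

/-- With `p = w + (1 + κ) / w`, the factor `p² - 4(1 + κ)` is the square of `w - (1 + κ) / w`, which
also divides `dp/dθ` and cancels. The remaining radicands agree up to an explicit square. -/
lemma abs_quadSubstDeriv_mul_ell {κ θ : ℝ} (hθ : θ ∈ Ioo 0 π)
    (hw : 2 * cos θ + κ - 1 ≠ 0) (hc : (2 * cos θ + κ - 1) ^ 2 ≠ 1 + κ) :
    |quadSubstDeriv κ θ| * ell κ (quadSubst κ θ) = densQ κ θ := by
  have hs : 0 < sin θ := sin_pos_of_mem_Ioo hθ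
  have hc1 : 0 < 1 + cos θ := by
    have : -1 < cos θ := by simpa using cos_lt_cos_of_nonneg_of_le_pi hθ.1.le le_rfl hθ.2
    linarith
  have hsc := sin_sq_add_cos_sq θ
  unfold quadSubstDeriv ell quadSubst densQ
  generalize cos θ = c at *
  generalize sin θ = s at *
  obtain ⟨w, hwd⟩ : ∃ w, w = 2 * c + κ - 1 := ⟨_, rfl⟩
  rw [← hwd] at hw hc ⊢
  set x := w - (1 + κ) / w with hx
  set R := (κ + 2 - (w + (1 + κ) / w)) * (w + (1 + κ) / w + 2 - κ) with hR
  set D := (2 * c ^ 2 - 1 + (1 + c) * κ) ^ 2 - 1 with hD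
  have hx0 : x ≠ 0 := by
    intro h
    apply hc
    rw [hx] at h
    field_simp at h
    linarith
  have e1 : (w + (1 + κ) / w) ^ 2 - 4 * (1 + κ) = x ^ 2 := by
    rw [hx]; field_simp; ring
  have e2 : |(1 - (1 + κ) / w ^ 2) * (-2 * s)| = |x| / |w| * (2 * s) := by
    have : (1 - (1 + κ) / w ^ 2) * (-2 * s) = -(x / w * (2 * s)) := by
      rw [hx]; field_simp
    rw [this, abs_neg, abs_mul, abs_div, abs_of_pos (show 0 < 2 * s by positivity)]
  have e3 : (|w| * (1 + c)) ^ 2 * R = (2 * s) ^ 2 * D := by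
    rw [mul_pow, sq_abs, hR, hD, mul_pow, show s ^ 2 = 1 - c ^ 2 by linarith]
    have hk : κ = w + 1 - 2 * c := by linarith
    rw [hk]
    field_simp
    ring
  have e4 : |w| * (1 + c) * √R = 2 * s * √D := by
    have := congrArg sqrt e3
    rwa [sqrt_mul (sq_nonneg _), sqrt_mul (sq_nonneg _), sqrt_sq (by positivity),
      sqrt_sq (by positivity)] at this
  have hw' : 0 < |w| := abs_pos.2 hw
  rw [e1, e2, sqrt_mul (sq_nonneg _), sqrt_sq_eq_abs]
  -- By `e4` the two square roots vanish together; in that case both sides are `0` through the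
  -- default value of the inverse.
  by_cases hD0 : √D = 0
  · have : √R = 0 := by
      rw [hD0, mul_zero] at e4
      exact (mul_eq_zero.1 e4).resolve_left (by positivity)
    simp [hD0, this]
  · have hR0 : √R ≠ 0 := by
      intro h
      rw [h, mul_zero] at e4
      exact (mul_ne_zero (by positivity) hD0) e4.symm
    have := abs_pos.2 hx0
    field_simp
    linarith

lemma measurable_quadSubst (κ : ℝ) : Measurable (quadSubst κ) := by
  unfold quadSubst; fun_prop

lemma lintegral_ell_image {κ : ℝ} {T : Set ℝ} (hT : MeasurableSet T) (hT0 : T ⊆ Ioo 0 π)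
    (hw : ∀ θ ∈ T, 2 * cos θ + κ - 1 ≠ 0) (hc : ∀ θ ∈ T, (2 * cos θ + κ - 1) ^ 2 ≠ 1 + κ)
    (hinj : InjOn (quadSubst κ) T) :
    ∫⁻ p in quadSubst κ '' T, ENNReal.ofReal (ell κ p) = ∫⁻ θ in T, ENNReal.ofReal (densQ κ θ) := by
  rw [lintegral_image_eq_lintegral_abs_deriv_mul hT
    (fun θ hθ => (hasDerivAt_quadSubst (hw θ hθ)).hasDerivWithinAt) hinj]
  refine setLIntegral_congr_fun hT fun θ hθ => ?_
  rw [← ENNReal.ofReal_mul (abs_nonneg _),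
    abs_quadSubstDeriv_mul_ell (hT0 hθ) (hw θ hθ) (hc θ hθ)]

/-- The fibres of `w ↦ w + (1 + κ) / w` are the pairs with product `1 + κ`; excluding that product
leaves injectivity. -/
lemma eq_of_quadSubst_eq {κ x y : ℝ} (hx : x ∈ Ioo 0 π) (hy : y ∈ Ioo 0 π)
    (hwx : 2 * cos x + κ - 1 ≠ 0) (hwy : 2 * cos y + κ - 1 ≠ 0)
    (hne : (2 * cos x + κ - 1) * (2 * cos y + κ - 1) ≠ 1 + κ)
    (h : quadSubst κ x = quadSubst κ y) : x = y := by
  unfold quadSubst at h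
  have h' : (2 * cos x + κ - 1 - (2 * cos y + κ - 1)) *
      ((2 * cos x + κ - 1) * (2 * cos y + κ - 1) - (1 + κ)) = 0 := by
    generalize 2 * cos x + κ - 1 = a at *
    generalize 2 * cos y + κ - 1 = b at *
    field_simp at h
    linarith
  rcases mul_eq_zero.1 h' with h1 | h1
  · exact injOn_cos (Ioo_subset_Icc_self hx) (Ioo_subset_Icc_self hy) (by linarith)
  · exact absurd (by linarith) hne

lemma cos_mem_Ioo {θ : ℝ} (hθ : θ ∈ Ioo 0 π) : cos θ ∈ Ioo (-1) 1 :=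
  ⟨by simpa using cos_lt_cos_of_nonneg_of_le_pi hθ.1.le le_rfl hθ.2,
    by simpa using cos_lt_cos_of_nonneg_of_le_pi le_rfl hθ.2.le hθ.1⟩

lemma exists_cos_eq {c : ℝ} (hc : c ∈ Ioo (-1) 1) : ∃ θ ∈ Ioo 0 π, cos θ = c :=
  ⟨arccos c, ⟨arccos_pos.2 hc.2, lt_of_le_of_ne (arccos_le_pi _) fun h => by
    linarith [arccos_eq_pi.1 h, hc.1]⟩, cos_arccos hc.1.le hc.2.le⟩

/-! ### Comparison of the parameter derivatives. -/

/-- The radicand of `densQ`, factored. -/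
lemma densQ_radicand (κ c : ℝ) :
    (2 * c ^ 2 - 1 + (1 + c) * κ) ^ 2 - 1
      = (1 + c) * (2 * c + κ - 2) * (2 * c ^ 2 + κ * c + κ) := by ring

lemma lintegral_densQ_of_lt {κ : ℝ} (hκ : κ < -1) :
    ∫⁻ θ in Ioo 0 π, ENNReal.ofReal (densQ κ θ)
      = ∫⁻ s in Ioo 0 π, ENNReal.ofReal (densP κ s) := by
  -- Off this set the radicand of `densQ` is nonpositive, so `densQ` vanishes there.
  set T : Set ℝ := {θ | θ ∈ Ioo 0 π ∧ κ - 2 < quadSubst κ θ}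
  have hT : MeasurableSet T :=
    measurableSet_Ioo.inter (measurableSet_lt measurable_const (measurable_quadSubst κ))
  have hw : ∀ θ ∈ Ioo 0 π, 2 * cos θ + κ - 1 < 1 + κ := fun θ hθ => by
    linarith [(cos_mem_Ioo hθ).2]
  have him : quadSubst κ '' T = Ioo (κ - 2) (κ + 2) := by
    ext p
    constructor
    · rintro ⟨θ, ⟨hθ, h⟩, rfl⟩
      refine ⟨h, ?_⟩
      have h1 := hw θ hθ
      unfold quadSubst
      generalize 2 * cos θ + κ - 1 = w at h1
      have hw0 : w < 0 := by linarith
      have : w + (1 + κ) / w - (κ + 2) = (w - 1) * (w - 1 - κ) / w := by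
        have := hw0.ne
        field_simp
        ring
      have : (w - 1) * (w - 1 - κ) / w < 0 :=
        div_neg_of_pos_of_neg (mul_pos_of_neg_of_neg (by linarith) (by linarith)) hw0
      linarith
    · rintro ⟨h1, h2⟩
      obtain ⟨w, hw0, hwp⟩ : ∃ w < 0, w ^ 2 - p * w + (1 + κ) = 0 := by
        -- The roots have product `1 + κ < 0`; this is the negative one.
        refine ⟨(p - √(p ^ 2 - 4 * (1 + κ))) / 2, ?_, ?_⟩
        · have : p < √(p ^ 2 - 4 * (1 + κ)) := lt_sqrt_of_sq_lt (by linarith)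
          linarith
        · have := sq_sqrt (show 0 ≤ p ^ 2 - 4 * (1 + κ) by nlinarith [sq_nonneg p])
          nlinarith
      have hb1 : w < 1 + κ := by
        by_contra! h
        nlinarith [mul_pos_of_neg_of_neg hw0 (sub_neg.2 h2),
          mul_nonneg (show 0 ≤ 1 - w by linarith) (sub_nonneg.2 h)]
      have hb2 : κ - 3 < w := by
        by_contra! h
        nlinarith [mul_pos (neg_pos.2 hw0) (sub_pos.2 h1)]
      obtain ⟨θ, hθ, hcθ⟩ := exists_cos_eq (c := (w + 1 - κ) / 2) ⟨by linarith, by linarith⟩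
      have hval : quadSubst κ θ = p := by
        unfold quadSubst
        rw [show 2 * cos θ + κ - 1 = w by rw [hcθ]; ring]
        have := hw0.ne
        field_simp
        linarith
      exact ⟨θ, ⟨hθ, by rw [hval]; exact h1⟩, hval⟩
  rw [lintegral_densP, ← him, lintegral_ell_image hT (fun θ h => h.1)]
  · refine setLIntegral_eq_of_subset_of_ae_eq_zero measurableSet_Ioo hT (fun θ h => h.1)
      (ae_of_all _ fun θ hθ hθT => ?_)
    have h1 : quadSubst κ θ ≤ κ - 2 := by
      by_contra! h
      exact hθT ⟨hθ, h⟩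
    have h2 := hw θ hθ
    have hc := cos_mem_Ioo hθ
    rw [densQ, densQ_radicand, sqrt_eq_zero_of_nonpos]
    · simp
    have h3 : 0 ≤ 2 * cos θ ^ 2 + κ * cos θ + κ := by
      unfold quadSubst at h1
      generalize hwd : 2 * cos θ + κ - 1 = w at *
      have hw0 : w < 0 := by linarith
      have : 2 * cos θ ^ 2 + κ * cos θ + κ = w * (w + (1 + κ) / w - (κ - 2)) / 2 := by
        have := hw0.ne
        field_simp
        rw [← hwd]
        ring
      rw [this]
      have := mul_nonneg_of_nonpos_of_nonpos hw0.le (sub_nonpos.2 h1)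
      linarith
    exact mul_nonpos_of_nonpos_of_nonneg
      (mul_nonpos_of_nonneg_of_nonpos (by linarith [hc.1]) (by linarith)) h3
  · intro θ hθ; linarith [hw θ hθ.1]
  · intro θ hθ h; nlinarith [sq_nonneg (2 * cos θ + κ - 1)]
  · intro x hx y hy h
    have h1 := hw x hx.1
    have h2 := hw y hy.1
    refine eq_of_quadSubst_eq hx.1 hy.1 (by linarith) (by linarith) (fun h' => ?_) h
    nlinarith [mul_pos_of_neg_of_neg (show 2 * cos x + κ - 1 < 0 by linarith)
      (show 2 * cos y + κ - 1 < 0 by linarith)]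

lemma lintegral_densQ_of_mem_Ioo {κ : ℝ} (hκ : κ ∈ Ioo 0 4) :
    ∫⁻ θ in Ioo 0 π, ENNReal.ofReal (densQ κ θ)
      = 2 * ∫⁻ s in Ioo 0 π, ENNReal.ofReal (densP κ s) := by
  obtain ⟨hκ0, hκ4⟩ := hκ
  obtain ⟨r, hr, hr2⟩ : ∃ r : ℝ, 1 < r ∧ r ^ 2 = 1 + κ :=
    ⟨√(1 + κ), by rw [lt_sqrt one_pos.le]; linarith, sq_sqrt (by linarith)⟩
  set W : ℝ → ℝ := fun θ => 2 * cos θ + κ - 1 with hW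
  have hWm : Measurable W := by fun_prop
  -- The two halves exchanged by `w ↦ (1 + κ) / w`, whose fixed point `r` is the critical point of
  -- the substitution, with value `2r`.
  set T₁ : Set ℝ := {θ | θ ∈ Ioo 0 π ∧ W θ ∈ Ioo 1 r}
  set T₂ : Set ℝ := {θ | θ ∈ Ioo 0 π ∧ W θ ∈ Ioi r}
  have hT₁ : MeasurableSet T₁ := measurableSet_Ioo.inter (hWm measurableSet_Ioo)
  have hT₂ : MeasurableSet T₂ := measurableSet_Ioo.inter (hWm measurableSet_Ioi)
  have hWlt : ∀ θ ∈ Ioo 0 π, W θ < 1 + κ := fun θ hθ => by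
    simp only [hW]; linarith [(cos_mem_Ioo hθ).2]
  have hrκ : r < 1 + κ := by nlinarith
  have hmaps : ∀ θ ∈ Ioo 0 π, 1 < W θ → W θ ≠ r → quadSubst κ θ ∈ Ioo (2 * r) (κ + 2) := by
    intro θ hθ h1 hne
    have h2 := hWlt θ hθ
    change W θ + (1 + κ) / W θ ∈ _
    generalize W θ = w at *
    have hw0 : 0 < w := by linarith
    have e1 : w + (1 + κ) / w - (κ + 2) = (w - 1) * (w - 1 - κ) / w := by field_simp; ring
    have e2 : w + (1 + κ) / w - 2 * r = (w - r) ^ 2 / w := by rw [← hr2]; field_simp; ring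
    have := div_neg_of_neg_of_pos
      (mul_neg_of_pos_of_neg (show 0 < w - 1 by linarith) (show w - 1 - κ < 0 by linarith)) hw0
    have := div_pos (sq_pos_of_ne_zero (sub_ne_zero.2 hne)) hw0
    exact ⟨by linarith, by linarith⟩
  have hsurj : ∀ p w : ℝ, 1 < w → w < 1 + κ → w ^ 2 - p * w + (1 + κ) = 0 →
      ∃ θ ∈ Ioo 0 π, W θ = w ∧ quadSubst κ θ = p := by
    intro p w h1 h2 h
    -- `W` takes the values in `(κ - 3, κ + 1)`; `κ < 4` is what puts all `w > 1` below `1 + κ` in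
    -- this range.
    obtain ⟨θ, hθ, hcθ⟩ := exists_cos_eq (c := (w + 1 - κ) / 2) ⟨by linarith, by linarith⟩
    have hWθ : W θ = w := by simp only [hW]; rw [hcθ]; ring
    refine ⟨θ, hθ, hWθ, ?_⟩
    change W θ + (1 + κ) / W θ = p
    rw [hWθ]
    field_simp
    linarith
  have him₁ : quadSubst κ '' T₁ = Ioo (2 * r) (κ + 2) := by
    ext p
    constructor
    · rintro ⟨θ, ⟨hθ, h⟩, rfl⟩
      exact hmaps θ hθ h.1 h.2.ne
    · rintro ⟨h1, h2⟩
      have hD : 0 < p ^ 2 - 4 * (1 + κ) := by nlinarith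
      have hsq := sq_sqrt hD.le
      have hpos := sqrt_pos.2 hD
      set q := √(p ^ 2 - 4 * (1 + κ))
      have hA : q < p - 2 := by nlinarith
      have hB : p - 2 * r < q := by nlinarith
      obtain ⟨θ, hθ, hWθ, hp⟩ := hsurj p ((p - q) / 2) (by linarith) (by linarith) (by nlinarith)
      exact ⟨θ, ⟨hθ, by rw [hWθ]; exact ⟨by linarith, by linarith⟩⟩, hp⟩
  have him₂ : quadSubst κ '' T₂ = Ioo (2 * r) (κ + 2) := by
    ext p
    constructor
    · rintro ⟨θ, ⟨hθ, h⟩, rfl⟩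
      exact hmaps θ hθ (hr.trans h) (ne_of_gt h)
    · rintro ⟨h1, h2⟩
      have hD : 0 < p ^ 2 - 4 * (1 + κ) := by nlinarith
      have hsq := sq_sqrt hD.le
      have hpos := sqrt_pos.2 hD
      set q := √(p ^ 2 - 4 * (1 + κ))
      have hA : q < 2 * (1 + κ) - p := by nlinarith
      obtain ⟨θ, hθ, hWθ, hp⟩ := hsurj p ((p + q) / 2) (by linarith) (by linarith) (by nlinarith)
      exact ⟨θ, ⟨hθ, by rw [hWθ]; exact show r < _ by linarith⟩, hp⟩
  have h₁ : ∫⁻ θ in T₁, ENNReal.ofReal (densQ κ θ)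
      = ∫⁻ p in Ioo (2 * r) (κ + 2), ENNReal.ofReal (ell κ p) := by
    rw [← him₁, lintegral_ell_image hT₁ (fun θ h => h.1)]
    · intro θ hθ; have : 1 < W θ := hθ.2.1; exact (by linarith : 0 < W θ).ne'
    · intro θ hθ
      change W θ ^ 2 ≠ _
      have h1 : 1 < W θ := hθ.2.1
      have h2 : W θ < r := hθ.2.2
      nlinarith
    · intro x hx y hy h
      have hx1 : 1 < W x := hx.2.1
      have hx2 : W x < r := hx.2.2
      have hy1 : 1 < W y := hy.2.1
      have hy2 : W y < r := hy.2.2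
      refine eq_of_quadSubst_eq hx.1 hy.1 (by linarith : 0 < W x).ne' (by linarith : 0 < W y).ne'
        (ne_of_lt ?_) h
      change W x * W y < _
      nlinarith
  have h₂ : ∫⁻ θ in T₂, ENNReal.ofReal (densQ κ θ)
      = ∫⁻ p in Ioo (2 * r) (κ + 2), ENNReal.ofReal (ell κ p) := by
    rw [← him₂, lintegral_ell_image hT₂ (fun θ h => h.1)]
    · intro θ hθ; have : r < W θ := hθ.2; exact (by linarith : 0 < W θ).ne'
    · intro θ hθ
      change W θ ^ 2 ≠ _
      have h2 : r < W θ := hθ.2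
      nlinarith
    · intro x hx y hy h
      have hx2 : r < W x := hx.2
      have hy2 : r < W y := hy.2
      refine eq_of_quadSubst_eq hx.1 hy.1 (by linarith : 0 < W x).ne' (by linarith : 0 < W y).ne'
        (ne_of_gt ?_) h
      change _ < W x * W y
      nlinarith
  have hdisj : Disjoint T₁ T₂ := by
    rw [Set.disjoint_left]
    intro θ h h'
    exact lt_asymm h.2.2 h'.2
  have hP : ∫⁻ s in Ioo 0 π, ENNReal.ofReal (densP κ s)
      = ∫⁻ p in Ioo (2 * r) (κ + 2), ENNReal.ofReal (ell κ p) := by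
    rw [lintegral_densP]
    -- For `p ≤ 2r` in the range, `p² ≤ 4(1 + κ)`, so `ell` takes its default value `0`.
    refine setLIntegral_eq_of_subset_of_ae_eq_zero measurableSet_Ioo measurableSet_Ioo
      (Ioo_subset_Ioo_left (by linarith)) (ae_of_all _ fun p hp hp' => ?_)
    have h1 : p ≤ 2 * r := by
      by_contra! h
      exact hp' ⟨h, hp.2⟩
    rw [ell, sqrt_eq_zero_of_nonpos]
    · simp
    · exact mul_nonpos_of_nonpos_of_nonneg (by nlinarith [hp.1])
        (mul_nonneg (by linarith [hp.2]) (by linarith [hp.1]))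
  rw [hP, two_mul]
  nth_rewrite 1 [← h₁]
  rw [← h₂, ← lintegral_union hT₂ hdisj]
  -- The only point with `W = r`, belonging to neither half; it is discarded as a null set.
  obtain ⟨θ₀, hθ₀, hWθ₀, -⟩ := hsurj (2 * r) r hr hrκ (by nlinarith)
  refine setLIntegral_eq_of_subset_of_ae_eq_zero measurableSet_Ioo (hT₁.union hT₂)
    (union_subset (fun θ h => h.1) (fun θ h => h.1)) ?_
  filter_upwards [compl_mem_ae_iff.2 (measure_singleton θ₀)] with θ hne hθ hθT
  have hW1 : W θ ≤ 1 := by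
    by_contra! h
    rcases lt_trichotomy (W θ) r with h' | h' | h'
    · exact hθT (Or.inl ⟨hθ, h, h'⟩)
    · refine hne (injOn_cos (Ioo_subset_Icc_self hθ) (Ioo_subset_Icc_self hθ₀) ?_)
      simp only [hW] at h' hWθ₀
      linarith
    · exact hθT (Or.inr ⟨hθ, h'⟩)
  have hc := cos_mem_Ioo hθ
  rw [densQ, densQ_radicand, sqrt_eq_zero_of_nonpos]
  · simp
  · simp only [hW] at hW1
    exact mul_nonpos_of_nonpos_of_nonneg
      (mul_nonpos_of_nonneg_of_nonpos (by linarith [hc.1]) (by linarith))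
      (by nlinarith [mul_pos hκ0 (show 0 < 1 + cos θ by linarith [hc.1])])

/-! ### Integration in the parameter. -/

/-- Jensen's formula on the fibres of `bosmanQ k`: the average of `log ‖bosmanQ k‖` over `y`. -/
noncomputable def jensenQ (k θ : ℝ) : ℝ := arcoshPlus |2 * cos θ ^ 2 - 1 + (1 + cos θ) * k|

/-- Jensen's formula on the fibres of `boydP (2 - k)`: the average of `log ‖boydP (2 - k)‖` over
`y`, up to the contribution of the leading coefficient. -/
noncomputable def jensenP (k s : ℝ) : ℝ :=
  arcoshPlus |-cos (s / 2) + (4 * cos (s / 2))⁻¹ * k|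

lemma arcoshPlus_abs {u : ℝ} (hu : -1 ≤ u) : arcoshPlus |u| = arcoshPlus u := by
  rcases le_total 0 u with h | h
  · rw [abs_of_nonneg h]
  · rw [abs_of_nonpos h, arcoshPlus_of_le_one (by linarith), arcoshPlus_of_le_one (by linarith)]

lemma measurable_densQ : Measurable fun z : ℝ × ℝ => densQ z.1 z.2 := by
  unfold densQ; fun_prop

lemma measurable_densP : Measurable fun z : ℝ × ℝ => densP z.1 z.2 := by
  unfold densP; fun_prop

lemma jensenQ_nonneg (k θ : ℝ) : 0 ≤ jensenQ k θ := arcoshPlus_nonneg _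

lemma jensenP_nonneg (k s : ℝ) : 0 ≤ jensenP k s := arcoshPlus_nonneg _

lemma measurable_jensenQ (k : ℝ) : Measurable (jensenQ k) :=
  continuous_arcoshPlus.measurable.comp (by fun_prop)

lemma measurable_jensenP (k : ℝ) : Measurable (jensenP k) :=
  continuous_arcoshPlus.measurable.comp (by fun_prop)

lemma cos_half_lt_one {s : ℝ} (hs : s ∈ Ioo 0 π) : cos (s / 2) < 1 :=
  (cos_mem_Ioo ⟨by linarith [hs.1], by linarith [hs.2, pi_pos]⟩).2

/-- Both Jensen terms are integrals of their densities from `κ = 0`, where the arguments lie in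
`[-1, 1]`. Nonnegativity lets Tonelli exchange the integrals without any integrability, and the
endpoint `κ = 4` is null. -/
lemma lintegral_jensenQ_eq_two_mul {k : ℝ} (h0 : 0 ≤ k) (h4 : k ≤ 4) :
    ∫⁻ θ in Ioo 0 π, ENNReal.ofReal (jensenQ k θ)
      = 2 * ∫⁻ s in Ioo 0 π, ENNReal.ofReal (jensenP k s) := by
  have hQ : ∀ θ ∈ Ioo 0 π, ENNReal.ofReal (jensenQ k θ)
      = ∫⁻ κ in Ioc 0 k, ENNReal.ofReal (densQ κ θ) := fun θ hθ => by
    have hc := cos_mem_Ioo hθ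
    unfold densQ
    rw [lintegral_inv_sqrt_affine (by linarith [hc.1]) (by nlinarith) h0, jensenQ,
      arcoshPlus_abs (by nlinarith [mul_nonneg (show 0 ≤ 1 + cos θ by linarith [hc.1]) h0]),
      arcoshPlus_of_le_one (u := _ + _ * 0) (by nlinarith [hc.1, hc.2]), sub_zero]
  have hP : ∀ s ∈ Ioo 0 π, ENNReal.ofReal (jensenP k s)
      = ∫⁻ κ in Ioc 0 k, ENNReal.ofReal (densP κ s) := fun s hs => by
    have hC := cos_half_pos hs
    have hC1 := cos_half_lt_one hs
    unfold densP
    have : 0 ≤ (4 * cos (s / 2))⁻¹ * k := by positivity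
    rw [lintegral_inv_sqrt_affine (by positivity) (by linarith) h0, jensenP,
      arcoshPlus_abs (by linarith),
      arcoshPlus_of_le_one (u := _ + _ * 0) (by linarith), sub_zero]
  have hsQ : ∫⁻ θ in Ioo 0 π, ∫⁻ κ in Ioc 0 k, ENNReal.ofReal (densQ κ θ)
      = ∫⁻ κ in Ioc 0 k, ∫⁻ θ in Ioo 0 π, ENNReal.ofReal (densQ κ θ) :=
    lintegral_lintegral_swap (measurable_densQ.comp measurable_swap).ennreal_ofReal.aemeasurable
  have hsP : ∫⁻ s in Ioo 0 π, ∫⁻ κ in Ioc 0 k, ENNReal.ofReal (densP κ s)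
      = ∫⁻ κ in Ioc 0 k, ∫⁻ s in Ioo 0 π, ENNReal.ofReal (densP κ s) :=
    lintegral_lintegral_swap (measurable_densP.comp measurable_swap).ennreal_ofReal.aemeasurable
  rw [setLIntegral_congr_fun measurableSet_Ioo hQ, setLIntegral_congr_fun measurableSet_Ioo hP,
    hsQ, hsP, ← lintegral_const_mul' _ _ (by simp)]
  refine lintegral_congr_ae ?_
  have hne : ∀ᵐ κ : ℝ, κ ≠ 4 := compl_mem_ae_iff.2 (measure_singleton 4)
  filter_upwards [ae_restrict_mem measurableSet_Ioc, ae_restrict_of_ae hne] with κ hκ hκ4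
  exact lintegral_densQ_of_mem_Ioo ⟨hκ.1, lt_of_le_of_ne (hκ.2.trans h4) hκ4⟩

lemma jensenQ_neg {K : ℝ} (hK : 1 ≤ K) {θ : ℝ} (hθ : θ ∈ Ioo 0 π) :
    jensenQ (-K) θ = arcoshPlus (-(2 * cos θ ^ 2 - 1) + (1 + cos θ) * K) := by
  have hc := cos_mem_Ioo hθ
  rw [jensenQ, ← abs_neg, arcoshPlus_abs]
  · congr 1; ring
  · nlinarith [mul_nonneg (show 0 ≤ 1 + cos θ by linarith [hc.1]) (sub_nonneg.2 hK), hc.1, hc.2]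

lemma jensenP_neg {K : ℝ} (hK : 1 ≤ K) {s : ℝ} (hs : s ∈ Ioo 0 π) :
    jensenP (-K) s = arcoshPlus (cos (s / 2) + (4 * cos (s / 2))⁻¹ * K) := by
  have hC := cos_half_pos hs
  have : 0 < cos (s / 2) + (4 * cos (s / 2))⁻¹ * K := by positivity
  rw [jensenP, ← abs_neg, arcoshPlus_abs]
  · congr 1; ring
  · linarith

lemma lintegral_jensenQ_sub {K L : ℝ} (hK : 1 ≤ K) (hL : K ≤ L) :
    ∫⁻ θ in Ioo 0 π, ENNReal.ofReal (jensenQ (-L) θ - jensenQ (-K) θ)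
      = ∫⁻ s in Ioo 0 π, ENNReal.ofReal (jensenP (-L) s - jensenP (-K) s) := by
  have hQ : ∀ θ ∈ Ioo 0 π, ENNReal.ofReal (jensenQ (-L) θ - jensenQ (-K) θ)
      = ∫⁻ κ in Ioc K L, ENNReal.ofReal (densQ (-κ) θ) := fun θ hθ => by
    have hc := cos_mem_Ioo hθ
    rw [jensenQ_neg hK hθ, jensenQ_neg (hK.trans hL) hθ, ← lintegral_inv_sqrt_affine
      (by linarith [hc.1])
      (by nlinarith [mul_nonneg (show 0 ≤ 1 + cos θ by linarith [hc.1]) (sub_nonneg.2 hK), hc.1, hc.2])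
      hL]
    refine lintegral_congr fun κ => ?_
    unfold densQ
    congr 4
    ring
  have hP : ∀ s ∈ Ioo 0 π, ENNReal.ofReal (jensenP (-L) s - jensenP (-K) s)
      = ∫⁻ κ in Ioc K L, ENNReal.ofReal (densP (-κ) s) := fun s hs => by
    have hC := cos_half_pos hs
    have : 0 < cos (s / 2) + (4 * cos (s / 2))⁻¹ * K := by positivity
    rw [jensenP_neg hK hs, jensenP_neg (hK.trans hL) hs, ← lintegral_inv_sqrt_affine
      (by positivity) (by linarith) hL]
    refine lintegral_congr fun κ => ?_
    unfold densP
    congr 4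
    ring
  have hm : Measurable fun z : ℝ × ℝ => (-z.2, z.1) := by fun_prop
  have hsQ : ∫⁻ θ in Ioo 0 π, ∫⁻ κ in Ioc K L, ENNReal.ofReal (densQ (-κ) θ)
      = ∫⁻ κ in Ioc K L, ∫⁻ θ in Ioo 0 π, ENNReal.ofReal (densQ (-κ) θ) :=
    lintegral_lintegral_swap (measurable_densQ.comp hm).ennreal_ofReal.aemeasurable
  have hsP : ∫⁻ s in Ioo 0 π, ∫⁻ κ in Ioc K L, ENNReal.ofReal (densP (-κ) s)
      = ∫⁻ κ in Ioc K L, ∫⁻ s in Ioo 0 π, ENNReal.ofReal (densP (-κ) s) :=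
    lintegral_lintegral_swap (measurable_densP.comp hm).ennreal_ofReal.aemeasurable
  rw [setLIntegral_congr_fun measurableSet_Ioo hQ, setLIntegral_congr_fun measurableSet_Ioo hP,
    hsQ, hsP]
  refine setLIntegral_congr_fun measurableSet_Ioc fun κ hκ => ?_
  -- The parameter is greater than `K` on `Ioc K L`, so the strict inequality holds even for `K =
  -- 1`.
  exact lintegral_densQ_of_lt (by linarith [hκ.1])

lemma jensenQ_mono {K L : ℝ} (hK : 1 ≤ K) (hL : K ≤ L) {θ : ℝ} (hθ : θ ∈ Ioo 0 π) :
    jensenQ (-K) θ ≤ jensenQ (-L) θ := by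
  rw [jensenQ_neg hK hθ, jensenQ_neg (hK.trans hL) hθ]
  have : 0 ≤ 1 + cos θ := by linarith [(cos_mem_Ioo hθ).1]
  exact monotone_arcoshPlus (by gcongr)

lemma jensenP_mono {K L : ℝ} (hK : 1 ≤ K) (hL : K ≤ L) {s : ℝ} (hs : s ∈ Ioo 0 π) :
    jensenP (-K) s ≤ jensenP (-L) s := by
  rw [jensenP_neg hK hs, jensenP_neg (hK.trans hL) hs]
  have := cos_half_pos hs
  exact monotone_arcoshPlus (by gcongr)

lemma integral_jensenQ_eq_two_mul {k : ℝ} (h0 : 0 ≤ k) (h4 : k ≤ 4) :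
    ∫ θ in Ioo 0 π, jensenQ k θ = 2 * ∫ s in Ioo 0 π, jensenP k s := by
  rw [integral_eq_lintegral_of_nonneg_ae (ae_of_all _ (jensenQ_nonneg k))
      (measurable_jensenQ k).aestronglyMeasurable,
    integral_eq_lintegral_of_nonneg_ae (ae_of_all _ (jensenP_nonneg k))
      (measurable_jensenP k).aestronglyMeasurable,
    lintegral_jensenQ_eq_two_mul h0 h4, ENNReal.toReal_mul]
  simp

lemma integral_jensenQ_sub {K L : ℝ} (hK : 1 ≤ K) (hL : K ≤ L) :
    ∫ θ in Ioo 0 π, (jensenQ (-L) θ - jensenQ (-K) θ)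
      = ∫ s in Ioo 0 π, (jensenP (-L) s - jensenP (-K) s) := by
  rw [integral_eq_lintegral_of_nonneg_ae, integral_eq_lintegral_of_nonneg_ae,
    lintegral_jensenQ_sub hK hL]
  · filter_upwards [ae_restrict_mem measurableSet_Ioo] with s hs
    exact sub_nonneg.2 (jensenP_mono hK hL hs)
  · exact ((measurable_jensenP _).sub (measurable_jensenP _)).aestronglyMeasurable
  · filter_upwards [ae_restrict_mem measurableSet_Ioo] with s hs
    exact sub_nonneg.2 (jensenQ_mono hK hL hs)
  · exact ((measurable_jensenQ _).sub (measurable_jensenQ _)).aestronglyMeasurable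

/-! ### Jensen's formula and Fubini. -/

open Polynomial in
-- The roots are `-zω` and `-wω` with `z + w = 2u`, `zw = 1`: both on the unit circle if `|u| ≤ 1`,
-- otherwise of moduli `exp (± arcosh |u|)`.
lemma logMahlerMeasure_quadratic {a ω : ℂ} (ha : a ≠ 0) (hω : ‖ω‖ = 1) (u : ℝ) :
    (C a * (X ^ 2 + C (2 * u * ω) * X + C (ω ^ 2))).logMahlerMeasure
      = Real.log ‖a‖ + arcoshPlus |u| := by
  obtain ⟨z, w, hsum, hprod, hlog⟩ : ∃ z w : ℂ, z + w = 2 * u ∧ z * w = 1 ∧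
      log⁺ ‖z‖ + log⁺ ‖w‖ = arcoshPlus |u| := by
    rcases le_total |u| 1 with hu | hu
    · refine ⟨Complex.exp (arccos u * Complex.I), Complex.exp (-(arccos u * Complex.I)), ?_, ?_, ?_⟩
      · have h := Complex.two_cos (arccos u : ℂ)
        rw [neg_mul] at h
        rw [← h, ← Complex.ofReal_cos, cos_arccos (abs_le.1 hu).1 (abs_le.1 hu).2]
      · rw [← Complex.exp_add]; simp
      · rw [← neg_mul, ← Complex.ofReal_neg, Complex.norm_exp_ofReal_mul_I,
          Complex.norm_exp_ofReal_mul_I, arcoshPlus_of_le_one hu]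
        simp
    · obtain ⟨ε, hε, hεu⟩ : ∃ ε : ℝ, ε * ε = 1 ∧ ε * |u| = u := by
        rcases le_total 0 u with h | h
        · exact ⟨1, by norm_num, by rw [abs_of_nonneg h, one_mul]⟩
        · exact ⟨-1, by norm_num, by rw [abs_of_nonpos h]; ring⟩
      have hA := arcosh_nonneg hu
      have hch := cosh_arcosh hu
      rw [cosh_eq] at hch
      have hε1 : |ε| = 1 := by
        have : |ε| * |ε| = 1 := by rw [← abs_mul, hε, abs_one]
        nlinarith [abs_nonneg ε]
      refine ⟨((ε * rexp (arcosh |u|) : ℝ) : ℂ), ((ε * rexp (-arcosh |u|) : ℝ) : ℂ), ?_, ?_, ?_⟩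
      · rw [← Complex.ofReal_add, ← mul_add,
          show rexp (arcosh |u|) + rexp (-arcosh |u|) = 2 * |u| by linarith]
        norm_cast
        linarith
      · rw [← Complex.ofReal_mul, mul_mul_mul_comm, hε, ← Real.exp_add]
        simp
      · rw [Complex.norm_real, Complex.norm_real, norm_mul, norm_mul, norm_eq_abs ε, hε1, one_mul,
          one_mul, norm_of_nonneg (exp_pos _).le, norm_of_nonneg (exp_pos _).le,
          arcoshPlus_of_one_le hu, posLog_apply, posLog_apply, log_exp, log_exp,
          max_eq_right hA, max_eq_left (by linarith), add_zero]
  have hfac : (X ^ 2 + C (2 * u * ω) * X + C (ω ^ 2) : ℂ[X])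
      = (X + C (z * ω)) * (X + C (w * ω)) := by
    rw [← hsum, show ω ^ 2 = (z * w) * ω ^ 2 by rw [hprod, one_mul]]
    simp only [map_mul, map_add, map_pow]
    ring
  have hne : ((X + C (z * ω)) * (X + C (w * ω)) : ℂ[X]) ≠ 0 :=
    mul_ne_zero (X_add_C_ne_zero _) (X_add_C_ne_zero _)
  rw [hfac, logMahlerMeasure_C_mul ha hne, logMahlerMeasure_mul_eq_add_logMahlerMeasure hne,
    logMahlerMeasure_X_add_C, logMahlerMeasure_X_add_C, norm_mul, norm_mul, hω, mul_one, mul_one,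
    hlog]

lemma continuous_eval_torus (P : MvPolynomial (Fin 2) ℂ) :
    Continuous fun θ : ℝ × ℝ => MvPolynomial.eval
      ![Complex.exp (θ.1 * Complex.I), Complex.exp (θ.2 * Complex.I)] P := by
  have : Continuous fun θ : ℝ × ℝ =>
      ![Complex.exp (θ.1 * Complex.I), Complex.exp (θ.2 * Complex.I)] := by
    refine continuous_pi fun i => ?_
    fin_cases i
    · simp only [Fin.zero_eta, Matrix.cons_val_zero]; fun_prop
    · simp only [Fin.mk_one, Matrix.cons_val_one]; fun_prop
  exact (MvPolynomial.continuous_eval P).comp this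

/-- Absolute convergence and Fubini for the two-variable Mahler measure, given Jensen's formula on
almost every fibre with an integrable lower bound. -/
lemma mahler_of_fibers {P : MvPolynomial (Fin 2) ℂ} {g l : ℝ → ℝ}
    (hfib : ∀ᵐ s : ℝ, ∃ p : Polynomial ℂ, (∀ t : ℝ, MvPolynomial.eval
      ![Complex.exp (s * Complex.I), Complex.exp (t * Complex.I)] P
        = p.eval (Complex.exp (t * Complex.I))) ∧ p.logMahlerMeasure = g s)
    (hl : IntegrableOn l (Icc 0 (2 * π))) (hlg : ∀ s, l s ≤ g s) :
    MahlerIntegrable P ∧ IntegrableOn g (Icc 0 (2 * π)) ∧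
      logMahler P = (2 * π)⁻¹ * ∫ s in Icc 0 (2 * π), g s := by
  have h2π : (0 : ℝ) ≤ 2 * π := by positivity
  set μ : Measure ℝ := volume.restrict (Icc 0 (2 * π)) with hμ
  have hvol : (volume : Measure (ℝ × ℝ)).restrict torusPeriod = μ.prod μ := by
    rw [torusPeriod, Measure.volume_eq_prod, hμ, Measure.prod_restrict]
  have hmeas : Measurable (logNormOnTorus P) :=
    measurable_log.comp (continuous_eval_torus P).norm.measurable
  have hfib' : ∀ᵐ s ∂μ, Integrable (fun t => logNormOnTorus P (s, t)) μ ∧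
      ∫ t, logNormOnTorus P (s, t) ∂μ = 2 * π * g s := by
    refine ae_restrict_of_ae ?_
    filter_upwards [hfib] with s hs
    obtain ⟨p, hp, hpg⟩ := hs
    have he : (fun t => logNormOnTorus P (s, t))
        = fun t => log ‖p.eval (circleMap 0 1 t)‖ := by
      funext t
      simp only [logNormOnTorus, hp, circleMap]
      simp
    rw [he]
    have hInt := Polynomial.intervalIntegrable_mahlerMeasure p
    refine ⟨(intervalIntegrable_iff_integrableOn_Icc_of_le h2π).1 hInt, ?_⟩
    rw [← hpg, Polynomial.logMahlerMeasure_def, circleAverage_def,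
      intervalIntegral.integral_of_le h2π, hμ, integral_Icc_eq_integral_Ioc, smul_eq_mul]
    field_simp
  obtain ⟨M, hM1, hM⟩ : ∃ M : ℝ, 1 ≤ M ∧ ∀ s ∈ Icc 0 (2 * π), ∀ t ∈ Icc 0 (2 * π),
      logNormOnTorus P (s, t) ≤ log M := by
    obtain ⟨B, hB⟩ := ((isCompact_Icc (a := (0 : ℝ)) (b := 2 * π)).prod
      (isCompact_Icc (a := (0 : ℝ)) (b := 2 * π))).exists_bound_of_continuousOn
      (continuous_eval_torus P).continuousOn
    refine ⟨max 1 B, le_max_left _ _, fun s hs t ht => ?_⟩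
    have hb := (hB (s, t) ⟨hs, ht⟩).trans (le_max_right 1 B)
    unfold logNormOnTorus
    rcases (norm_nonneg (MvPolynomial.eval
      ![Complex.exp ((s, t).1 * Complex.I), Complex.exp ((s, t).2 * Complex.I)] P)).eq_or_lt
      with h | h
    · rw [← h, log_zero]; exact log_nonneg (le_max_left _ _)
    · exact log_le_log h hb
  have hInt : Integrable (logNormOnTorus P) (μ.prod μ) := by
    rw [integrable_prod_iff hmeas.aestronglyMeasurable]
    refine ⟨hfib'.mono fun s hs => hs.1, ?_⟩
    -- Since `f ≤ log M` and `log M ≥ 0`, one has `|f| ≤ 2 log M - f`, so a lower bound on the fibre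
    -- means controls the fibre `L¹` norms.
    refine Integrable.mono' (g := fun s => 2 * π * (2 * log M - l s))
      (((integrable_const _).sub hl).const_mul _)
      hmeas.aestronglyMeasurable.norm.integral_prod_right' ?_
    filter_upwards [hfib', ae_restrict_mem measurableSet_Icc] with s hs hsI
    rw [norm_of_nonneg (integral_nonneg fun _ => norm_nonneg _)]
    calc ∫ t, ‖logNormOnTorus P (s, t)‖ ∂μ
        ≤ ∫ t, (2 * log M - logNormOnTorus P (s, t)) ∂μ := by
          refine integral_mono_ae hs.1.norm ((integrable_const _).sub hs.1) ?_
          filter_upwards [ae_restrict_mem measurableSet_Icc] with t ht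
          have h1 := hM s hsI t ht
          have h2 := log_nonneg hM1
          rw [norm_eq_abs, abs_le]
          constructor <;> linarith
      _ = 2 * π * (2 * log M - g s) := by
          rw [integral_sub (integrable_const _) hs.1, hs.2, integral_const, hμ]
          simp [measureReal_restrict_apply, h2π]
          ring
      _ ≤ 2 * π * (2 * log M - l s) := by
          have := hlg s
          gcongr
  have hinner := hInt.integral_prod_left
  have hg : Integrable g μ := by
    have := hinner.const_mul (2 * π)⁻¹
    refine this.congr ?_
    filter_upwards [hfib'] with s hs
    rw [hs.2]
    field_simp
  refine ⟨by rw [MahlerIntegrable, IntegrableOn, hvol]; exact hInt, hg, ?_⟩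
  rw [logMahler, hvol, integral_prod _ hInt, integral_congr_ae (hfib'.mono fun s hs => hs.2),
    integral_const_mul]
  field_simp

lemma two_mul_cos_mul_exp (x : ℝ) :
    2 * (cos x : ℂ) * Complex.exp (x * Complex.I) = Complex.exp (x * Complex.I) ^ 2 + 1 := by
  have h : Complex.exp (-x * Complex.I) * Complex.exp (x * Complex.I) = 1 := by
    rw [← Complex.exp_add]; simp
  rw [Complex.ofReal_cos, Complex.two_cos]
  linear_combination h

lemma bosmanQ_mahler (k : ℝ) :
    MahlerIntegrable (bosmanQ (k : ℂ)) ∧ IntegrableOn (jensenQ k) (Icc 0 (2 * π)) ∧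
      logMahler (bosmanQ (k : ℂ)) = (2 * π)⁻¹ * ∫ s in Icc 0 (2 * π), jensenQ k s := by
  refine mahler_of_fibers (l := fun _ => 0) (ae_of_all _ fun s => ?_)
    (integrable_const _) (jensenQ_nonneg k)
  have hx := two_mul_cos_mul_exp s
  have hn := Complex.norm_exp_ofReal_mul_I s
  generalize Complex.exp (s * Complex.I) = x at hx hn
  refine ⟨_, fun t => ?_, (logMahlerMeasure_quadratic (a := 1) (ω := x ^ 2) one_ne_zero
    (by rw [norm_pow, hn, one_pow]) (2 * cos s ^ 2 - 1 + (1 + cos s) * k)).trans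
    (by simp [jensenQ])⟩
  generalize Complex.exp (t * Complex.I) = y
  simp only [bosmanQ, map_add, map_mul, map_pow, MvPolynomial.eval_X, MvPolynomial.eval_C,
    map_one, Matrix.cons_val_zero, Matrix.cons_val_one, Polynomial.eval_add, Polynomial.eval_mul,
    Polynomial.eval_pow, Polynomial.eval_X, Polynomial.eval_C, one_mul]
  push_cast [-Complex.ofReal_cos]
  linear_combination
    (-(2 * (cos s : ℂ) * x + x ^ 2 + 1) * y - k * x * y) * hx

lemma ae_cos_half_ne_zero : ∀ᵐ s : ℝ, cos (s / 2) ≠ 0 := by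
  have : {s : ℝ | ¬cos (s / 2) ≠ 0}.Countable := by
    refine (countable_range fun n : ℤ => (2 * (n : ℝ) + 1) * π).mono fun s hs => ?_
    obtain ⟨n, hn⟩ := cos_eq_zero_iff.1 (not_not.1 hs)
    exact ⟨n, by simp only; linarith⟩
  exact this.measure_zero _

lemma exp_add_one_eq (s : ℝ) : Complex.exp (s * Complex.I) + 1
    = 2 * (cos (s / 2) : ℂ) * Complex.exp ((s / 2 : ℝ) * Complex.I) := by
  rw [two_mul_cos_mul_exp, sq, ← Complex.exp_add]
  congr 2
  push_cast
  ring

lemma log_abs_two_mul_cos_half (s : ℝ) :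
    log |2 * cos (s / 2)| = log ‖(Polynomial.X + Polynomial.C 1 : Polynomial ℂ).eval
      (circleMap 0 1 s)‖ := by
  simp only [circleMap, Polynomial.eval_add, Polynomial.eval_X, Polynomial.eval_C, zero_add,
    Complex.ofReal_one, one_mul]
  rw [exp_add_one_eq, norm_mul, Complex.norm_exp_ofReal_mul_I, mul_one]
  congr 1
  rw [norm_mul, abs_mul, Complex.norm_real, norm_eq_abs]
  simp

lemma integrableOn_log_abs_cos_half :
    IntegrableOn (fun s => log |2 * cos (s / 2)|) (Icc 0 (2 * π)) := by
  simp only [log_abs_two_mul_cos_half]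
  exact (intervalIntegrable_iff_integrableOn_Icc_of_le (by positivity)).1
    (Polynomial.intervalIntegrable_mahlerMeasure _)

lemma integral_log_abs_cos_half : ∫ s in Icc 0 (2 * π), log |2 * cos (s / 2)| = 0 := by
  simp only [log_abs_two_mul_cos_half]
  have h := Polynomial.logMahlerMeasure_X_add_C 1
  rw [Polynomial.logMahlerMeasure_def, circleAverage_def,
    intervalIntegral.integral_of_le (by positivity), ← integral_Icc_eq_integral_Ioc] at h
  simpa [pi_ne_zero] using h

lemma boydP_mahler (k : ℝ) :
    MahlerIntegrable (boydP (2 - (k : ℂ))) ∧ IntegrableOn (jensenP k) (Icc 0 (2 * π)) ∧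
      logMahler (boydP (2 - (k : ℂ))) = (2 * π)⁻¹ * ∫ s in Icc 0 (2 * π), jensenP k s := by
  have hfib : ∀ᵐ s : ℝ, ∃ p : Polynomial ℂ, (∀ t : ℝ, MvPolynomial.eval
      ![Complex.exp (s * Complex.I), Complex.exp (t * Complex.I)] (boydP (2 - (k : ℂ)))
        = p.eval (Complex.exp (t * Complex.I))) ∧
      p.logMahlerMeasure = log |2 * cos (s / 2)| + jensenP k s := by
    -- Where `cos (s / 2) = 0` the leading coefficient `x + 1` vanishes.
    filter_upwards [ae_cos_half_ne_zero] with s hs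
    have hx := exp_add_one_eq s
    have hn := Complex.norm_exp_ofReal_mul_I (s / 2)
    have hω := two_mul_cos_mul_exp (s / 2)
    have hc : (cos (s / 2) : ℂ) ≠ 0 := Complex.ofReal_ne_zero.2 hs
    have hω0 := Complex.exp_ne_zero ((s / 2 : ℝ) * Complex.I)
    have hnc : ‖2 * (cos (s / 2) : ℂ)‖ = |2 * cos (s / 2)| := by
      rw [norm_mul, abs_mul, Complex.norm_real, norm_eq_abs]; simp
    generalize Complex.exp ((s / 2 : ℝ) * Complex.I) = ω at *
    refine ⟨_, fun t => ?_, (logMahlerMeasure_quadratic (a := 2 * (cos (s / 2) : ℂ) * ω)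
      (ω := -ω) (mul_ne_zero (mul_ne_zero two_ne_zero hc) hω0) (by rw [norm_neg, hn])
      (-cos (s / 2) + (4 * cos (s / 2))⁻¹ * k)).trans
      (by rw [norm_mul, hn, mul_one, hnc, jensenP])⟩
    have hx' : Complex.exp (s * Complex.I) = ω ^ 2 := by linear_combination hx + hω
    rw [hx']
    generalize Complex.exp (t * Complex.I) = y
    simp only [boydP, map_add, map_mul, map_pow, MvPolynomial.eval_X, MvPolynomial.eval_C,
      map_one, Matrix.cons_val_zero, Matrix.cons_val_one, Polynomial.eval_add,
      Polynomial.eval_mul, Polynomial.eval_pow, Polynomial.eval_X, Polynomial.eval_C]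
    push_cast [-Complex.ofReal_cos]
    generalize ((cos (s / 2) : ℝ) : ℂ) = c at *
    have hinv : 2 * c * ω * (y ^ 2 + 2 * (-c + (4 * c)⁻¹ * k) * -ω * y + (-ω) ^ 2)
        = 2 * c * ω * y ^ 2 + (4 * c ^ 2 - k) * ω ^ 2 * y + 2 * c * ω * ω ^ 2 := by
      field_simp
      ring
    rw [hinv]
    linear_combination (-(y ^ 2) - (2 * c * ω + ω ^ 2 + 1) * y - ω ^ 2) * hω
  obtain ⟨h1, h2, h3⟩ := mahler_of_fibers hfib integrableOn_log_abs_cos_half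
    (fun s => le_add_of_nonneg_right (jensenP_nonneg k s))
  have hP : IntegrableOn (jensenP k) (Icc 0 (2 * π)) :=
    (h2.sub integrableOn_log_abs_cos_half).congr (ae_of_all _ fun s => by simp)
  refine ⟨h1, hP, ?_⟩
  rw [h3, integral_add integrableOn_log_abs_cos_half hP, integral_log_abs_cos_half, zero_add]

/-! ### Reduction to the half period `(0, π)`. -/

lemma integral_eq_two_mul_of_symm {g : ℝ → ℝ} (hg : IntegrableOn g (Icc 0 (2 * π)))
    (hs : ∀ s, g (2 * π - s) = g s) :
    ∫ s in Icc 0 (2 * π), g s = 2 * ∫ s in Ioo 0 π, g s := by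
  have hπ := pi_pos
  have hI : IntervalIntegrable g volume 0 (2 * π) :=
    (intervalIntegrable_iff_integrableOn_Icc_of_le (by linarith)).2 hg
  have hsub : ∫ s in π..(2 * π), g s = ∫ s in 0..π, g s := by
    have := intervalIntegral.integral_comp_sub_left g (a := 0) (b := π) (2 * π)
    simp only [hs] at this
    rw [this]
    congr 1 <;> ring
  have hadd := intervalIntegral.integral_add_adjacent_intervals
    (hI.mono_set (c := 0) (d := π) (by
      rw [uIcc_of_le hπ.le, uIcc_of_le (by linarith)]; exact Icc_subset_Icc_right (by linarith)))
    (hI.mono_set (c := π) (d := 2 * π) (by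
      rw [uIcc_of_le (by linarith), uIcc_of_le (by linarith)]
      exact Icc_subset_Icc_left (by linarith)))
  rw [integral_Icc_eq_integral_Ioc, ← intervalIntegral.integral_of_le (by linarith), ← hadd, hsub,
    intervalIntegral.integral_of_le hπ.le, integral_Ioc_eq_integral_Ioo]
  ring

lemma cos_half_symm (s : ℝ) : cos ((2 * π - s) / 2) = -cos (s / 2) := by
  rw [show (2 * π - s) / 2 = π - s / 2 by ring, cos_pi_sub]

lemma Ioo_subset_period : Ioo 0 π ⊆ Icc 0 (2 * π) := fun s hs =>
  ⟨hs.1.le, by linarith [hs.2, pi_pos]⟩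

lemma logMahler_bosmanQ (k : ℝ) :
    logMahler (bosmanQ (k : ℂ)) = π⁻¹ * ∫ s in Ioo 0 π, jensenQ k s := by
  obtain ⟨-, h2, h3⟩ := bosmanQ_mahler k
  rw [h3, integral_eq_two_mul_of_symm h2 fun s => by rw [jensenQ, cos_two_pi_sub, jensenQ]]
  field_simp

lemma logMahler_boydP (k : ℝ) :
    logMahler (boydP (2 - (k : ℂ))) = π⁻¹ * ∫ s in Ioo 0 π, jensenP k s := by
  obtain ⟨-, h2, h3⟩ := boydP_mahler k
  rw [h3, integral_eq_two_mul_of_symm h2 fun s => by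
    rw [jensenP, cos_half_symm, jensenP, ← abs_neg]
    congr 2
    rw [mul_neg, inv_neg]
    ring]
  field_simp

lemma logMahler_sub_eq {K L : ℝ} (hK : 1 ≤ K) (hL : K ≤ L) :
    logMahler (bosmanQ ((-L : ℝ) : ℂ)) - logMahler (boydP (2 - ((-L : ℝ) : ℂ)))
      = logMahler (bosmanQ ((-K : ℝ) : ℂ)) - logMahler (boydP (2 - ((-K : ℝ) : ℂ))) := by
  have hQ : ∀ k, IntegrableOn (jensenQ k) (Ioo 0 π) := fun k =>
    (bosmanQ_mahler k).2.1.mono_set Ioo_subset_period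
  have hP : ∀ k, IntegrableOn (jensenP k) (Ioo 0 π) := fun k =>
    (boydP_mahler k).2.1.mono_set Ioo_subset_period
  have h := integral_jensenQ_sub hK hL
  rw [integral_sub (hQ _) (hQ _), integral_sub (hP _) (hP _)] at h
  simp only [logMahler_bosmanQ, logMahler_boydP]
  linear_combination π⁻¹ * h

/-! ### Asymptotics as the parameter tends to `-∞`. -/

/-- The identity `P_{2+K} - Kxy = (x + 1)(y + 1)(x + y)` makes `|P_{2+K}|` equal to `K` up to a
bounded error, uniformly on the torus. -/
lemma norm_boydP_sub_le (K : ℂ) {x y : ℂ} (hx : ‖x‖ = 1) (hy : ‖y‖ = 1) :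
    ‖MvPolynomial.eval ![x, y] (boydP (2 + K)) - K * x * y‖ ≤ 8 := by
  have : MvPolynomial.eval ![x, y] (boydP (2 + K)) - K * x * y = (x + 1) * (y + 1) * (x + y) := by
    simp only [boydP, map_add, map_mul, map_pow, MvPolynomial.eval_X, MvPolynomial.eval_C,
      map_one, Matrix.cons_val_zero, Matrix.cons_val_one]
    ring
  rw [this, norm_mul, norm_mul]
  have h1 : ‖x + 1‖ ≤ 2 := (norm_add_le _ _).trans (by rw [hx, norm_one]; norm_num)
  have h2 : ‖y + 1‖ ≤ 2 := (norm_add_le _ _).trans (by rw [hy, norm_one]; norm_num)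
  have h3 : ‖x + y‖ ≤ 2 := (norm_add_le _ _).trans (by rw [hx, hy]; norm_num)
  calc ‖x + 1‖ * ‖y + 1‖ * ‖x + y‖ ≤ 2 * 2 * 2 := by gcongr
    _ = 8 := by norm_num

lemma logNormOnTorus_boydP_mem {K : ℝ} (hK : 8 < K) (θ : ℝ × ℝ) :
    logNormOnTorus (boydP (2 - ((-K : ℝ) : ℂ))) θ ∈ Icc (log (K - 8)) (log (K + 8)) := by
  have hx := Complex.norm_exp_ofReal_mul_I θ.1
  have hy := Complex.norm_exp_ofReal_mul_I θ.2
  unfold logNormOnTorus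
  rw [show (2 : ℂ) - ((-K : ℝ) : ℂ) = 2 + (K : ℂ) by push_cast; ring]
  generalize Complex.exp (θ.1 * Complex.I) = x at *
  generalize Complex.exp (θ.2 * Complex.I) = y at *
  have h := norm_boydP_sub_le (K : ℂ) hx hy
  have hKn : ‖(K : ℂ) * x * y‖ = K := by
    rw [norm_mul, norm_mul, hx, hy, Complex.norm_real, norm_of_nonneg (by linarith)]; ring
  generalize MvPolynomial.eval ![x, y] (boydP (2 + (K : ℂ))) = z at h
  have h1 := norm_sub_norm_le z (K * x * y)
  have h2 := norm_sub_norm_le (K * x * y) z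
  rw [norm_sub_rev] at h2
  exact ⟨log_le_log (by linarith) (by linarith), log_le_log (by linarith) (by linarith)⟩

lemma logMahler_boydP_mem {K : ℝ} (hK : 8 < K) :
    logMahler (boydP (2 - ((-K : ℝ) : ℂ))) ∈ Icc (log (K - 8)) (log (K + 8)) := by
  have hInt := (boydP_mahler (-K)).1
  have hvol : (volume : Measure (ℝ × ℝ)).real torusPeriod = (2 * π) ^ 2 := by
    rw [torusPeriod, Measure.volume_eq_prod, measureReal_prod_prod]
    simp [pi_pos.le]
    ring
  have hfin : volume torusPeriod ≠ ⊤ :=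
    (isCompact_Icc.prod isCompact_Icc).measure_ne_top
  have hconst : ∀ a : ℝ, ((2 * π) ^ 2)⁻¹ * ∫ _ in torusPeriod, a = a := fun a => by
    rw [setIntegral_const, hvol, smul_eq_mul]
    field_simp
  have hmeas : MeasurableSet torusPeriod := measurableSet_Icc.prod measurableSet_Icc
  rw [logMahler]
  constructor
  · rw [← hconst (log (K - 8))]
    exact mul_le_mul_of_nonneg_left (setIntegral_mono_on (integrableOn_const hfin) hInt hmeas
      fun θ _ => (logNormOnTorus_boydP_mem hK θ).1) (by positivity)
  · rw [← hconst (log (K + 8))]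
    exact mul_le_mul_of_nonneg_left (setIntegral_mono_on hInt (integrableOn_const hfin) hmeas
      fun θ _ => (logNormOnTorus_boydP_mem hK θ).2) (by positivity)

lemma tendsto_log_add_sub_log (a : ℝ) :
    Tendsto (fun K => log (K + a) - log K) atTop (𝓝 0) := by
  have h : Tendsto (fun K : ℝ => log (1 + a * K⁻¹)) atTop (𝓝 0) := by
    have h1 : Tendsto (fun K : ℝ => 1 + a * K⁻¹) atTop (𝓝 1) := by
      simpa using (tendsto_inv_atTop_zero.const_mul a).const_add 1
    simpa using h1.log one_ne_zero
  refine h.congr' ?_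
  filter_upwards [eventually_gt_atTop 0, eventually_gt_atTop (-a)] with K hK hKa
  rw [← log_div (by linarith) hK.ne']
  congr 1
  field_simp

lemma tendsto_logMahler_boydP :
    Tendsto (fun K : ℝ => logMahler (boydP (2 - ((-K : ℝ) : ℂ))) - log K) atTop (𝓝 0) := by
  refine tendsto_of_tendsto_of_tendsto_of_le_of_le' (tendsto_log_add_sub_log (-8))
    (tendsto_log_add_sub_log 8) ?_ ?_
  · filter_upwards [eventually_gt_atTop 8] with K hK
    have := (logMahler_boydP_mem hK).1
    rw [← sub_eq_add_neg]
    linarith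
  · filter_upwards [eventually_gt_atTop 8] with K hK
    have := (logMahler_boydP_mem hK).2
    linarith

/-- The main term is `log (2(1 + cos θ)K)`. The argument `u` of `arcoshPlus` is within `1` of `(1 +
cos θ)K`, and `2 max(1, u) - 1 ≤ exp (arcoshPlus u) ≤ 2 max(1, u)`; this produces the shifts `-3`
and `+2`. -/
lemma jensenQ_sub_log_mem {K : ℝ} (hK : 1 ≤ K) {θ : ℝ} (hθ : θ ∈ Ioo 0 π) :
    jensenQ (-K) θ - (log K + 2 * log |2 * cos (θ / 2)|) ∈
      Icc (log (max 1 (2 * (1 + cos θ) * K - 3)) - log (2 * (1 + cos θ) * K))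
        (log (2 * (1 + cos θ) * K + 2) - log (2 * (1 + cos θ) * K)) := by
  have hc := cos_mem_Ioo hθ
  have hC := cos_half_pos hθ
  have hcs : cos θ = 2 * cos (θ / 2) ^ 2 - 1 := by rw [← cos_two_mul]; congr 1; ring
  have hy : 0 < 2 * (1 + cos θ) * K := mul_pos (by linarith [hc.1]) (by linarith)
  have hlog : log K + 2 * log |2 * cos (θ / 2)| = log (2 * (1 + cos θ) * K) := by
    rw [log_abs, show 2 * (1 + cos θ) * K = K * (2 * cos (θ / 2)) ^ 2 by rw [hcs]; ring,
      log_mul (x := K) (by linarith) (by positivity), log_pow]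
    push_cast
    ring
  have hup := exp_arcoshPlus_le (-(2 * cos θ ^ 2 - 1) + (1 + cos θ) * K)
  have hlo := le_exp_arcoshPlus (-(2 * cos θ ^ 2 - 1) + (1 + cos θ) * K)
  rw [hlog, jensenQ_neg hK hθ]
  set u := -(2 * cos θ ^ 2 - 1) + (1 + cos θ) * K with hu
  have h1 := le_max_left 1 u
  have h2 := le_max_right 1 u
  constructor
  · refine sub_le_sub_right ((log_le_iff_le_exp (by positivity)).2 (le_trans ?_ hlo)) _
    refine max_le (by linarith) ?_
    nlinarith [hc.1, hc.2]
  · refine sub_le_sub_right ((le_log_iff_exp_le (by positivity)).2 (hup.trans ?_)) _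
    have : max 1 u ≤ (1 + cos θ) * K + 1 :=
      max_le (by linarith) (by rw [hu]; nlinarith [sq_nonneg (cos θ)])
    linarith

lemma integral_log_abs_cos_half_Ioo : ∫ s in Ioo 0 π, log |2 * cos (s / 2)| = 0 := by
  have h := integral_eq_two_mul_of_symm integrableOn_log_abs_cos_half fun s => by
    rw [cos_half_symm, mul_neg, abs_neg]
  rw [integral_log_abs_cos_half] at h
  linarith

/-- The estimate is not uniform near `θ = π`, where `1 + cos θ` vanishes, so dominated convergence
is used. The subtracted `2 log |2 cos (θ / 2)|` has integral zero. -/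
lemma tendsto_logMahler_bosmanQ :
    Tendsto (fun K : ℝ => logMahler (bosmanQ ((-K : ℝ) : ℂ)) - log K) atTop (𝓝 0) := by
  set μ := (volume : Measure ℝ).restrict (Ioo 0 π)
  have hb : Integrable (fun s => log |2 * cos (s / 2)|) μ :=
    integrableOn_log_abs_cos_half.mono_set Ioo_subset_period
  have hlim : Tendsto (fun K : ℝ => ∫ θ, (jensenQ (-K) θ - (log K + 2 * log |2 * cos (θ / 2)|)) ∂μ)
      atTop (𝓝 (∫ _, (0 : ℝ) ∂μ)) := by
    refine tendsto_integral_filter_of_dominated_convergence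
      (fun θ => log 6 + 2 * |log (|2 * cos (θ / 2)|)|) ?_ ?_ ?_ ?_
    · refine Eventually.of_forall fun K => ?_
      refine ((measurable_jensenQ _).sub (Measurable.add measurable_const ?_)).aestronglyMeasurable
      fun_prop
    · filter_upwards [eventually_ge_atTop 1] with K hK
      filter_upwards [ae_restrict_mem measurableSet_Ioo] with θ hθ
      obtain ⟨h1, h2⟩ := jensenQ_sub_log_mem hK hθ
      have hc := cos_mem_Ioo hθ
      have hC := cos_half_pos hθ
      have hcs : cos θ = 2 * cos (θ / 2) ^ 2 - 1 := by rw [← cos_two_mul]; congr 1; ring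
      have ha : 0 < 2 * (1 + cos θ) := by linarith [hc.1]
      have hla : log (2 * (1 + cos θ)) = 2 * log |2 * cos (θ / 2)| := by
        rw [log_abs, show 2 * (1 + cos θ) = (2 * cos (θ / 2)) ^ 2 by rw [hcs]; ring, log_pow]
        push_cast
        ring
      have ha4 : 2 * (1 + cos θ) < 4 := by linarith [hc.2]
      generalize 2 * (1 + cos θ) = a at *
      have hy : 0 < a * K := by positivity
      have habs := neg_abs_le (log (|2 * cos (θ / 2)|))
      have hnn := abs_nonneg (log |2 * cos (θ / 2)|)
      rw [norm_eq_abs, abs_le]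
      constructor
      · have h3 : log (a * K) ≤ log 4 + log (max 1 (a * K - 3)) := by
          rw [← log_mul (by norm_num) (by positivity)]
          refine log_le_log hy ?_
          have := le_max_left 1 (a * K - 3)
          have := le_max_right 1 (a * K - 3)
          linarith
        have h4 : log 4 ≤ log 6 := log_le_log (by norm_num) (by norm_num)
        linarith
      · have h3 : log (a * K + 2) ≤ log 6 + log (a * K) - log a := by
          rw [← log_mul (by norm_num) hy.ne', ← log_div (by positivity) ha.ne']
          refine log_le_log (by positivity) ?_
          rw [show 6 * (a * K) / a = 6 * K by field_simp]
          nlinarith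
        linarith
    · exact (integrable_const _).add (hb.abs.const_mul 2)
    · filter_upwards [ae_restrict_mem measurableSet_Ioo] with θ hθ
      have ha : 0 < 2 * (1 + cos θ) := by linarith [(cos_mem_Ioo hθ).1]
      have hat : Tendsto (fun K : ℝ => 2 * (1 + cos θ) * K) atTop atTop :=
        tendsto_id.const_mul_atTop ha
      refine tendsto_of_tendsto_of_tendsto_of_le_of_le'
        ((tendsto_log_add_sub_log (-3)).comp hat) ((tendsto_log_add_sub_log 2).comp hat) ?_ ?_
      · filter_upwards [eventually_ge_atTop 1, hat.eventually_gt_atTop 3] with K hK hK3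
        refine le_trans ?_ (jensenQ_sub_log_mem hK hθ).1
        simp only [Function.comp, ← sub_eq_add_neg]
        exact sub_le_sub_right (log_le_log (by linarith) (le_max_right _ _)) _
      · filter_upwards [eventually_ge_atTop 1] with K hK
        exact (jensenQ_sub_log_mem hK hθ).2
  have h2 := hlim.const_mul π⁻¹
  rw [integral_zero, mul_zero] at h2
  refine h2.congr fun K => ?_
  have hQ : Integrable (jensenQ (-K)) μ := (bosmanQ_mahler (-K)).2.1.mono_set Ioo_subset_period
  have hR : Integrable (fun s => log K + 2 * log |2 * cos (s / 2)|) μ :=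
    (integrable_const _).add (hb.const_mul 2)
  rw [integral_sub hQ hR, integral_add (integrable_const _) (hb.const_mul 2), integral_const_mul,
    integral_log_abs_cos_half_Ioo, logMahler_bosmanQ, mul_sub]
  simp [μ, pi_pos.le]

theorem theorem1 (k : ℝ) :
    (MahlerIntegrable (bosmanQ (k : ℂ)) ∧ MahlerIntegrable (boydP (2 - (k : ℂ)))) ∧
    (0 ≤ k ∧ k ≤ 4 → logMahler (bosmanQ (k : ℂ)) = 2 * logMahler (boydP (2 - (k : ℂ)))) ∧
    (k ≤ -1 → logMahler (bosmanQ (k : ℂ)) = logMahler (boydP (2 - (k : ℂ)))) := by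
  refine ⟨⟨(bosmanQ_mahler k).1, (boydP_mahler k).1⟩, fun h => ?_, fun h => ?_⟩
  · rw [logMahler_bosmanQ, logMahler_boydP, integral_jensenQ_eq_two_mul h.1 h.2]
    ring
  · have hlim := tendsto_logMahler_bosmanQ.sub tendsto_logMahler_boydP
    -- The difference does not depend on `L ≥ -k`, so it equals its limit `0`.
    have hconst : ∀ᶠ L : ℝ in atTop,
        logMahler (bosmanQ ((-L : ℝ) : ℂ)) - log L
            - (logMahler (boydP (2 - ((-L : ℝ) : ℂ))) - log L)
          = logMahler (bosmanQ (k : ℂ)) - logMahler (boydP (2 - (k : ℂ))) := by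
      filter_upwards [eventually_ge_atTop (-k)] with L hL
      have := logMahler_sub_eq (K := -k) (by linarith) hL
      rw [neg_neg] at this
      linarith
    have := tendsto_nhds_unique (hlim.congr' hconst) tendsto_const_nhds
    linarith
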